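/- Let $d\ge 1$, let $D\subset\mathbb{R}^d$ be a bounded domain (open and connected), and let $V:D\to\mathbb{R}$ be bounded from below with $V\in L^p(D)$, where $p\in[1,\infty]$ if $d=1$, $p\in(1,\infty]$ if $d=2$, and $p\in[d/2,\infty]$ if $d\ge 3$. Let $\mathcal{H}=-\tfrac12\Delta+V$ be the self-adjoint Neumann realization in $L^2(D)$, that is, the operator of the quadratic form $\tfrac12\int_D\nabla u\cdot\nabla w+\int_D Vuw$ with form domain $\{u\in H^1(D): Vu^2\in L^1(D)\}$. Let $(f_m)_{m\in\mathbb{N}^d}$ be an orthonormal basis of $L^2(D)$ consisting of real eigenfunctions of $\mathcal{H}$, $\mathcal{H}f_m=\lambda_m f_m$. Let $T>0$ and let $g(x,t,y)$, $t\in(0,T]$, be the heat kernel, i.e. the positive fundamental solution, of the Neumann problem for $\partial_t u=\tfrac12\Delta u-Vu$ on $D\times(0,T]$: for every $\varphi\in L^2(D)$, $u(x,t)=\int_D g(x,t,y)\varphi(y)\,dy$ satisfies $\partial_t u=-\mathcal{H}u$ for $t\in(0,T]$ and $u(\cdot,t)\to\varphi$ in $L^2(D)$ as $t\to0^+$. For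 $m\in\mathbb{N}^d$ put $\varphi_{m,0}=f_m$, $\psi_{m,T}=e^{T\lambda_m}f_m$ and $$\mu_m(G)=\int_{G\cap(D\times D)}\varphi_{m,0}(x)\,g(x,T,y)\,\psi_{m,T}(y)\,dx\,dy$$ for Borel sets $G$. Then, for every $m\in\mathbb{N}^d$: (i) the integrand is integrable on $D\times D$, and $\mu_m$ is a (finite) signed measure; (ii) $\mu_m$ is not a positive measure, with the possible exception of the ground state: if $\lambda_n\le\lambda_m$ for some $n\ne m$, then $\mu_m(G)<0$ for some Borel set $G$; (iii) if $\mathcal{Z}(T):=\sum_{n\in\mathbb{N}^d}e^{-T\lambda_n}<\infty$, then $\mu_m(D\times D)=1$. -/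

import Mathlib

open MeasureTheory Set Filter Topology
open scoped ContDiff ENNReal

/-- The real Hilbert space `L²(D)`, with respect to Lebesgue measure on `D ⊆ ℝᵈ`. -/
abbrev L2 {d : ℕ} (D : Set (EuclideanSpace ℝ (Fin d))) : Type :=
  Lp ℝ 2 (volume.restrict D)

/-- Square-integrable vector fields on `D`. -/
abbrev L2Field {d : ℕ} (D : Set (EuclideanSpace ℝ (Fin d))) : Type :=
  Lp (EuclideanSpace ℝ (Fin d)) 2 (volume.restrict D)

/-- The field `G ∈ L²(D; ℝᵈ)` is the weak gradient of `u ∈ L²(D)`: integration by parts holds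
against every smooth function with compact support in `D`. Thus `u ∈ H¹(D)` if and only if
such a field exists. -/
def HasWeakGradient {d : ℕ} (D : Set (EuclideanSpace ℝ (Fin d)))
    (u : L2 D) (G : L2Field D) : Prop :=
  ∀ χ : EuclideanSpace ℝ (Fin d) → ℝ,
    ContDiff ℝ ∞ χ → HasCompactSupport χ → tsupport χ ⊆ D →
    ∀ e : EuclideanSpace ℝ (Fin d),
      ∫ x in D, u x * fderiv ℝ χ x e = - ∫ x in D, inner ℝ (G x) e * χ x

/-- `u` belongs to the form domain `{u ∈ H¹(D) : V u² ∈ L¹(D)}`, and `G` is its gradient. -/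
def InFormDomain {d : ℕ} (D : Set (EuclideanSpace ℝ (Fin d)))
    (V : EuclideanSpace ℝ (Fin d) → ℝ) (u : L2 D) (G : L2Field D) : Prop :=
  HasWeakGradient D u G ∧ IntegrableOn (fun x => V x * u x ^ 2) D

/-- The graph of the realization in `L²(D)` of `ℋ = -½ Δ + V` with Neumann boundary conditions:
`u` is in the domain of `ℋ` and `ℋ u = h`. This is the operator of the quadratic form
`½ ∫ ∇u · ∇w + ∫ V u w`; the test functions `w` are not required to vanish at the boundary,
which encodes the Neumann condition. -/
def NeumannSchrodinger {d : ℕ} (D : Set (EuclideanSpace ℝ (Fin d)))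
    (V : EuclideanSpace ℝ (Fin d) → ℝ) (u h : L2 D) : Prop :=
  ∃ G : L2Field D, InFormDomain D V u G ∧
    ∀ (w : L2 D) (K : L2Field D), InFormDomain D V w K →
      (1 / 2 : ℝ) * (∫ x in D, inner ℝ (G x) (K x)) + ∫ x in D, V x * u x * w x
        = ∫ x in D, h x * w x

/-- `u` solves `∂ₜ u = ½ Δ u - V u` on `D × (0, T]` with Neumann boundary condition
and initial datum `φ`, as a curve in `L²(D)`. -/
def IsHeatSolution {d : ℕ} (D : Set (EuclideanSpace ℝ (Fin d)))
    (V : EuclideanSpace ℝ (Fin d) → ℝ) (T : ℝ) (φ : L2 D) (u : ℝ → L2 D) : Prop :=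
  Tendsto u (𝓝[>] 0) (𝓝 φ) ∧
    ∀ t ∈ Ioc 0 T, ∃ h : L2 D,
      NeumannSchrodinger D V (u t) h ∧ HasDerivWithinAt u (-h) (Ioc 0 T) t

/-- `g` is the heat kernel, i.e. the positive fundamental solution, of the Neumann problem for
`∂ₜ u = ½ Δ u - V u` on `D × (0, T]`: for every initial datum `φ ∈ L²(D)`, the function
`(x, t) ↦ ∫ g(x, t, y) φ(y) dy` is the solution. (The function `g(·, t, ·)` is thereby
determined up to a null set.) -/
structure IsHeatKernel {d : ℕ} (D : Set (EuclideanSpace ℝ (Fin d)))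
    (V : EuclideanSpace ℝ (Fin d) → ℝ) (T : ℝ)
    (g : EuclideanSpace ℝ (Fin d) → ℝ → EuclideanSpace ℝ (Fin d) → ℝ) : Prop where
  measurable : ∀ t ∈ Ioc 0 T,
    AEStronglyMeasurable (fun p : EuclideanSpace ℝ (Fin d) × EuclideanSpace ℝ (Fin d) =>
      g p.1 t p.2) (volume.restrict (D ×ˢ D))
  pos : ∀ t ∈ Ioc 0 T,
    ∀ᵐ p : EuclideanSpace ℝ (Fin d) × EuclideanSpace ℝ (Fin d) ∂(volume.restrict (D ×ˢ D)),
      0 < g p.1 t p.2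
  solves : ∀ φ : L2 D, ∃ u : ℝ → L2 D, IsHeatSolution D V T φ u ∧
    ∀ t ∈ Ioc 0 T, ∀ᵐ x ∂(volume.restrict D),
      IntegrableOn (fun y => g x t y * φ y) D ∧ u t x = ∫ y in D, g x t y * φ y

/-- The density `φ₀(x) g(x, T, y) ψ_T(y)` of the joint endpoint distribution. -/
def endpointDensity {d : ℕ} (g : EuclideanSpace ℝ (Fin d) → ℝ → EuclideanSpace ℝ (Fin d) → ℝ)
    (T : ℝ) (φ ψ : EuclideanSpace ℝ (Fin d) → ℝ)
    (p : EuclideanSpace ℝ (Fin d) × EuclideanSpace ℝ (Fin d)) : ℝ :=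
  φ p.1 * g p.1 T p.2 * ψ p.2

/-! Let `P` be the integral operator with kernel `g(·, T, ·)`. Symmetry of the form makes `exp (t *
λ) * ⟪u t, f⟫` constant along a heat solution `u` for an eigenfunction `f` of eigenvalue `λ`, so `P`
multiplies `f m` by `exp (-T * lam m)`. By Fubini the total mass is `exp (T * lam m) * ⟪f m, P (f
m)⟫ = 1`.

If the measure were nonnegative, the rectangle where `f m` is positive in the first variable and
negative in the second would be null, since the density is negative there. Then `f m` has constant
sign, and Perron–Frobenius for the positive kernel makes `lam m` strictly smaller than every other
eigenvalue, contradicting `lam n ≤ lam m`. -/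

/-- A nonnegative, nonzero function has a positive integral against a positive weight. -/
theorem integral_mul_pos_of_ae_pos {α : Type*} [MeasurableSpace α] {μ : Measure α}
    {w φ : α → ℝ} (hw : ∀ᵐ y ∂μ, 0 < w y) (hφ : 0 ≤ᵐ[μ] φ) (hne : ¬ φ =ᵐ[μ] 0)
    (hint : Integrable (fun y => w y * φ y) μ) : 0 < ∫ y, w y * φ y ∂μ := by
  have hnn : 0 ≤ᵐ[μ] fun y => w y * φ y := by
    filter_upwards [hw, hφ] with y h1 h2 using mul_nonneg h1.le h2
  refine lt_of_le_of_ne (integral_nonneg_of_ae hnn) fun h => hne ?_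
  filter_upwards [(integral_eq_zero_iff_of_nonneg_ae hnn hint).1 h.symm, hw] with y h1 h2
  exact (mul_eq_zero.1 h1).resolve_left h2.ne'

theorem Lp_not_ae_eq_zero {α : Type*} [MeasurableSpace α] {μ : Measure α}
    {φ : Lp ℝ 2 μ} (hne : φ ≠ 0) : ¬ (φ : α → ℝ) =ᵐ[μ] 0 :=
  fun h => hne ((Lp.eq_zero_iff_ae_eq_zero).2 h)

theorem inner_L2_eq_integral_mul {α : Type*} [MeasurableSpace α] {μ : Measure α}
    (φ ψ : Lp ℝ 2 μ) : inner ℝ φ ψ = ∫ x, φ x * ψ x ∂μ := by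
  rw [L2.inner_def]
  exact integral_congr_ae (Eventually.of_forall fun x => by simp [mul_comm])

theorem integrable_mul_L2 {α : Type*} [MeasurableSpace α] {μ : Measure α}
    (φ ψ : Lp ℝ 2 μ) : Integrable (fun x => φ x * ψ x) μ :=
  (Lp.memLp φ).integrable_mul (Lp.memLp ψ)

/-! ### Integral operators with positive kernel. -/

/-- `P` is the integral operator on `L²(μ)` with kernel `k`. -/
def IsKernelOperator {α : Type*} [MeasurableSpace α] (μ : Measure α) (k : α → α → ℝ)
    (P : Lp ℝ 2 μ → Lp ℝ 2 μ) : Prop :=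
  ∀ φ : Lp ℝ 2 μ, ∀ᵐ x ∂μ,
    Integrable (fun y => k x y * φ y) μ ∧ P φ x = ∫ y, k x y * φ y ∂μ

namespace IsKernelOperator

variable {α : Type*} [MeasurableSpace α] {μ : Measure α} {k : α → α → ℝ}
  {P : Lp ℝ 2 μ → Lp ℝ 2 μ}

theorem ae_pos (hP : IsKernelOperator μ k P) (hk : ∀ᵐ x ∂μ, ∀ᵐ y ∂μ, 0 < k x y)
    {φ : Lp ℝ 2 μ} (hφ : 0 ≤ᵐ[μ] φ) (hne : φ ≠ 0) : ∀ᵐ x ∂μ, 0 < P φ x := by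
  filter_upwards [hP φ, hk] with x hx hkx
  rw [hx.2]
  exact integral_mul_pos_of_ae_pos hkx hφ (Lp_not_ae_eq_zero hne) hx.1

theorem map_add (hP : IsKernelOperator μ k P) (φ ψ : Lp ℝ 2 μ) :
    P (φ + ψ) = P φ + P ψ := by
  refine Lp.ext ?_
  filter_upwards [hP φ, hP ψ, hP (φ + ψ), Lp.coeFn_add (P φ) (P ψ)] with x h1 h2 h3 h4
  rw [h4, Pi.add_apply, h1.2, h2.2, h3.2, ← integral_add h1.1 h2.1]
  refine integral_congr_ae ?_
  filter_upwards [Lp.coeFn_add φ ψ] with y hy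
  rw [hy, Pi.add_apply, mul_add]

theorem map_neg (hP : IsKernelOperator μ k P) (φ : Lp ℝ 2 μ) : P (-φ) = -P φ := by
  have h0 : P 0 = 0 := by simpa using hP.map_add 0 0
  have h := hP.map_add φ (-φ)
  rw [add_neg_cancel, h0] at h
  exact (neg_eq_of_add_eq_zero_right h.symm).symm

/-- Perron–Frobenius: the eigenvalue of a nonnegative eigenfunction strictly dominates the
eigenvalues of the eigenfunctions orthogonal to it. -/
theorem eigenvalue_lt (hP : IsKernelOperator μ k P) (hk : ∀ᵐ x ∂μ, ∀ᵐ y ∂μ, 0 < k x y)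
    {s f : Lp ℝ 2 μ} {b c : ℝ} (hc : 0 < c) (hs : 0 ≤ᵐ[μ] s) (hs0 : s ≠ 0) (hPs : P s = c • s)
    (hsymm : ∀ φ, inner ℝ (P φ) s = c * inner ℝ φ s)
    (hf0 : f ≠ 0) (hfs : inner ℝ f s = 0) (hPf : P f = b • f) : b < c := by
  -- Since `c • s = P s` and `P` turns nonnegative nonzero functions into positive ones, `s` is
  -- positive.
  have hspos : ∀ᵐ x ∂μ, 0 < s x := by
    filter_upwards [hP.ae_pos hk hs hs0, Lp.coeFn_smul c s] with x h1 h2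
    rw [hPs, h2, Pi.smul_apply, smul_eq_mul] at h1
    exact pos_of_mul_pos_right h1 hc.le
  have inner_pos : ∀ φ : Lp ℝ 2 μ, 0 ≤ᵐ[μ] φ → φ ≠ 0 → 0 < inner ℝ φ s := by
    intro φ hφ hne
    rw [real_inner_comm, inner_L2_eq_integral_mul]
    exact integral_mul_pos_of_ae_pos hspos hφ (Lp_not_ae_eq_zero hne) (integrable_mul_L2 s φ)
  have habs : 0 ≤ᵐ[μ] (|f| : Lp ℝ 2 μ) := by
    filter_upwards [Lp.coeFn_abs f] with x hx
    rw [hx]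
    exact abs_nonneg _
  -- Orthogonality to the positive `s` forbids `h = |h|`, so `P (|f| - h)` is positive. Taking `h =
  -- f` and `h = -f` gives `b * |f| < P |f|`.
  have key : ∀ h : Lp ℝ 2 μ, |h| = |f| → h ≠ 0 → inner ℝ h s = 0 →
      P h = b • h → ∀ᵐ x ∂μ, b * h x < P |f| x := by
    intro h hhf hh0 hhs hPh
    have hnn : 0 ≤ᵐ[μ] (|f| - h : Lp ℝ 2 μ) := by
      filter_upwards [Lp.coeFn_abs h, Lp.coeFn_sub |f| h] with x h1 h2
      rw [h2, Pi.sub_apply, ← hhf, h1]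
      exact sub_nonneg.2 (le_abs_self _)
    have hne : |f| - h ≠ 0 := by
      intro h0
      rw [sub_eq_zero] at h0
      exact (inner_pos h (h0 ▸ habs) hh0).ne' hhs
    have hadd := hP.map_add (|f| - h) h
    rw [sub_add_cancel, hPh] at hadd
    filter_upwards [hP.ae_pos hk hnn hne, Lp.coeFn_add (P (|f| - h)) (b • h),
      Lp.coeFn_smul b h] with x h1 h2 h3
    rw [hadd, h2, Pi.add_apply, h3, Pi.smul_apply, smul_eq_mul]
    linarith
  have hlt : ∀ᵐ x ∂μ, b * |f x| < P |f| x := by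
    filter_upwards [key f rfl hf0 hfs hPf,
      key (-f) (abs_neg f) (neg_ne_zero.2 hf0) (by rw [inner_neg_left, hfs, neg_zero])
        (by rw [hP.map_neg, hPf, smul_neg]), Lp.coeFn_neg f] with x h1 h2 h3
    rw [h3, Pi.neg_apply] at h2
    rcases abs_cases (f x) with h | h <;> rw [h.1] <;> assumption
  -- By `hsymm` this pairing equals `(c - b) * ⟪|f|, s⟫`.
  have hdiff : 0 < inner ℝ (P |f| - b • |f|) s := by
    have hd : ∀ᵐ x ∂μ, 0 < (P |f| - b • |f| : Lp ℝ 2 μ) x := by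
      filter_upwards [hlt, Lp.coeFn_sub (P |f|) (b • |f|), Lp.coeFn_smul b |f|,
        Lp.coeFn_abs f] with x h1 h2 h3 h4
      rw [h2, Pi.sub_apply, h3, Pi.smul_apply, smul_eq_mul, h4]
      linarith
    refine inner_pos _ (hd.mono fun x hx => hx.le) fun h0 => hs0 ?_
    refine (Lp.eq_zero_iff_ae_eq_zero).2 ?_
    filter_upwards [hd, (Lp.eq_zero_iff_ae_eq_zero).1 h0] with x h1 h2
    exact absurd h2 h1.ne'
  have hfpos : 0 < inner ℝ |f| s := by
    refine inner_pos _ habs fun h0 => hf0 ((Lp.eq_zero_iff_ae_eq_zero).2 ?_)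
    filter_upwards [(Lp.eq_zero_iff_ae_eq_zero).1 h0, Lp.coeFn_abs f] with x h1 h2
    exact abs_eq_zero.1 (h2.symm.trans h1)
  rw [inner_sub_left, hsymm, real_inner_smul_left, ← sub_mul] at hdiff
  linarith [pos_of_mul_pos_left hdiff hfpos.le]

/-- Tonelli: integrating the absolute value in `y` leaves `|φ| * P |ψ|`, a product of two `L²`
functions. -/
theorem integrable_prod [SFinite μ] (hP : IsKernelOperator μ k P)
    (hk : ∀ᵐ x ∂μ, ∀ᵐ y ∂μ, 0 < k x y)
    (hkm : AEStronglyMeasurable (fun p : α × α => k p.1 p.2) (μ.prod μ)) (φ ψ : Lp ℝ 2 μ) :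
    Integrable (fun p : α × α => φ p.1 * k p.1 p.2 * ψ p.2) (μ.prod μ) := by
  have hmeas : AEStronglyMeasurable (fun p : α × α => φ p.1 * k p.1 p.2 * ψ p.2) (μ.prod μ) :=
    ((Lp.aestronglyMeasurable φ).comp_fst.mul hkm).mul (Lp.aestronglyMeasurable ψ).comp_snd
  refine (integrable_prod_iff hmeas).2 ⟨?_, ?_⟩
  · filter_upwards [hP ψ] with x hx
    simpa only [mul_assoc] using hx.1.const_mul (φ x)
  · refine (integrable_mul_L2 |φ| (P |ψ|)).congr ?_
    filter_upwards [hP |ψ|, hk, Lp.coeFn_abs φ] with x hx hkx hφx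
    rw [hφx, hx.2, ← integral_const_mul]
    refine integral_congr_ae ?_
    filter_upwards [hkx, Lp.coeFn_abs ψ] with y h1 h2
    simp only [h2, norm_mul, Real.norm_eq_abs, abs_of_pos h1, mul_assoc]

theorem integral_prod_eq_inner [SFinite μ] (hP : IsKernelOperator μ k P)
    (hk : ∀ᵐ x ∂μ, ∀ᵐ y ∂μ, 0 < k x y)
    (hkm : AEStronglyMeasurable (fun p : α × α => k p.1 p.2) (μ.prod μ)) (φ ψ : Lp ℝ 2 μ) :
    ∫ p : α × α, φ p.1 * k p.1 p.2 * ψ p.2 ∂(μ.prod μ) = inner ℝ φ (P ψ) := by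
  rw [MeasureTheory.integral_prod _ (hP.integrable_prod hk hkm φ ψ), inner_L2_eq_integral_mul]
  refine integral_congr_ae ?_
  filter_upwards [hP ψ] with x hx
  simp only [hx.2, mul_assoc, integral_const_mul]

end IsKernelOperator

/-! ### Heat flow against eigenfunctions. -/

section Heat

variable {d : ℕ} {D : Set (EuclideanSpace ℝ (Fin d))} {V : EuclideanSpace ℝ (Fin d) → ℝ}

/-- Each function is admissible as a test function for the other, and the form is symmetric. -/
theorem NeumannSchrodinger.inner_comm {u h w k : L2 D} (hu : NeumannSchrodinger D V u h)
    (hw : NeumannSchrodinger D V w k) : inner ℝ h w = inner ℝ u k := by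
  obtain ⟨G, hG, hGt⟩ := hu
  obtain ⟨K, hK, hKt⟩ := hw
  have h1 := hGt w K hK
  have h2 := hKt u G hG
  rw [real_inner_comm k u, inner_L2_eq_integral_mul, inner_L2_eq_integral_mul, ← h1, ← h2]
  simp only [real_inner_comm, mul_right_comm]

/-- The coefficient of a heat solution along an eigenfunction decays exponentially. -/
theorem IsHeatSolution.inner_eq {T : ℝ} (hT : 0 < T) {φ f : L2 D} {u : ℝ → L2 D} {l : ℝ}
    (hu : IsHeatSolution D V T φ u) (hf : NeumannSchrodinger D V f (l • f)) :
    inner ℝ (u T) f = Real.exp (-T * l) * inner ℝ φ f := by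
  set y : ℝ → ℝ := fun t => Real.exp (t * l) * inner ℝ (u t) f with hy
  have hderiv : ∀ t ∈ Ioc 0 T, HasDerivWithinAt y 0 (Ioc 0 T) t := by
    intro t ht
    obtain ⟨h, hh, hd⟩ := hu.2 t ht
    have h1 : HasDerivWithinAt (fun t => Real.exp (t * l)) (Real.exp (t * l) * l) (Ioc 0 T) t := by
      simpa using (((hasDerivAt_id t).mul_const l).exp).hasDerivWithinAt
    have h2 := h1.mul (hd.inner ℝ (hasDerivWithinAt_const t (Ioc 0 T) f))
    refine h2.congr_deriv ?_
    rw [inner_zero_right, inner_neg_left, hh.inner_comm hf, real_inner_smul_right]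
    ring
  have hconst : ∀ t ∈ Ioc 0 T, y t = y T := fun t ht =>
    (convex_Ioc 0 T).is_const_of_fderivWithin_eq_zero (𝕜 := ℝ)
      (fun z hz => (hderiv z hz).differentiableWithinAt)
      (fun z hz => by
        ext
        simpa [derivWithin] using (hderiv z hz).derivWithin
          ((uniqueDiffOn_Ioc 0 T) z hz))
      ht ⟨hT, le_rfl⟩
  -- The equation holds only for `t > 0`; the initial datum enters through the limit at `0`.
  have hlim : Tendsto y (𝓝[>] 0) (𝓝 (Real.exp (0 * l) * inner ℝ φ f)) := by
    refine Tendsto.mul ?_ (hu.1.inner tendsto_const_nhds)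
    exact ((by fun_prop : Continuous fun t : ℝ => Real.exp (t * l)).tendsto 0).mono_left
      nhdsWithin_le_nhds
  have hlim' : Tendsto y (𝓝[>] 0) (𝓝 (y T)) := by
    refine tendsto_const_nhds.congr' ?_
    filter_upwards [Ioc_mem_nhdsGT hT] with t ht using (hconst t ht).symm
  have hyT := tendsto_nhds_unique hlim' hlim
  rw [zero_mul, Real.exp_zero, one_mul] at hyT
  rw [← hyT, hy, ← mul_assoc, ← Real.exp_add, neg_mul, neg_add_cancel, Real.exp_zero, one_mul]

/-- The time-`T` propagator of a heat kernel is diagonal in a basis of eigenfunctions. -/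
theorem IsHeatKernel.exists_propagator {T : ℝ} (hT : 0 < T)
    {g : EuclideanSpace ℝ (Fin d) → ℝ → EuclideanSpace ℝ (Fin d) → ℝ}
    (hg : IsHeatKernel D V T g) {ι : Type*} (f : HilbertBasis ι ℝ (L2 D)) (lam : ι → ℝ)
    (hf : ∀ m, NeumannSchrodinger D V (f m) (lam m • f m)) :
    ∃ P : L2 D → L2 D, IsKernelOperator (volume.restrict D) (fun x y => g x T y) P ∧
      (∀ φ m, inner ℝ (P φ) (f m) = Real.exp (-T * lam m) * inner ℝ φ (f m)) ∧
      ∀ m, P (f m) = Real.exp (-T * lam m) • f m := by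
  choose u hu hk using hg.solves
  have hP : ∀ φ m, inner ℝ (u φ T) (f m) = Real.exp (-T * lam m) * inner ℝ φ (f m) :=
    fun φ m => (hu φ).inner_eq hT (hf m)
  refine ⟨fun φ => u φ T, fun φ => hk φ T ⟨hT, le_rfl⟩, hP, fun m => ?_⟩
  -- Compare coefficients in the basis: only the one at `n = m` survives.
  refine f.repr.injective (lp.ext (funext fun n => ?_))
  rw [f.repr_apply_apply, f.repr_apply_apply, real_inner_comm, hP, real_inner_smul_right,
    real_inner_comm (f m) (f n)]
  rcases eq_or_ne m n with rfl | hmn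
  · rfl
  · simp [f.orthonormal.2 hmn]

end Heat

/-! ### The endpoint measure. -/

theorem lemma1 {d : ℕ} (hd : 1 ≤ d)
    (D : Set (EuclideanSpace ℝ (Fin d)))
    (hDopen : IsOpen D) (hDconn : IsConnected D) (hDbdd : Bornology.IsBounded D)
    (V : EuclideanSpace ℝ (Fin d) → ℝ) (p : ℝ≥0∞)
    (hp1 : 1 ≤ p) (hp2 : d = 2 → 1 < p) (hp3 : 3 ≤ d → (d : ℝ≥0∞) / 2 ≤ p)
    (hVp : MemLp V p (volume.restrict D))
    (hVbelow : ∃ c : ℝ, ∀ x ∈ D, c ≤ V x)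
    (T : ℝ) (hT : 0 < T)
    (f : HilbertBasis (Fin d → ℕ) ℝ (L2 D)) (lam : (Fin d → ℕ) → ℝ)
    (hf : ∀ m, NeumannSchrodinger D V (f m) (lam m • f m))
    (g : EuclideanSpace ℝ (Fin d) → ℝ → EuclideanSpace ℝ (Fin d) → ℝ)
    (hg : IsHeatKernel D V T g) (m : Fin d → ℕ) :
    IntegrableOn (endpointDensity g T (f m) (fun y => Real.exp (T * lam m) * f m y)) (D ×ˢ D) ∧
    ∃ μ : SignedMeasure (EuclideanSpace ℝ (Fin d) × EuclideanSpace ℝ (Fin d)),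
      (∀ G, MeasurableSet G →
        μ G = ∫ q in G ∩ D ×ˢ D,
          endpointDensity g T (f m) (fun y => Real.exp (T * lam m) * f m y) q) ∧
      ((∃ n, n ≠ m ∧ lam n ≤ lam m) → ∃ G, MeasurableSet G ∧ μ G < 0) ∧
      (Summable (fun n => Real.exp (-T * lam n)) → μ (D ×ˢ D) = 1) := by
  set μ := volume.restrict D with hμ
  have hprod : (volume.restrict (D ×ˢ D) :
      Measure (EuclideanSpace ℝ (Fin d) × EuclideanSpace ℝ (Fin d))) = μ.prod μ := by
    rw [hμ, Measure.prod_restrict, Measure.volume_eq_prod]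
  have hTT : T ∈ Ioc 0 T := ⟨hT, le_rfl⟩
  have hgm := hg.measurable T hTT
  have hgpos := hg.pos T hTT
  rw [hprod] at hgm hgpos
  have hk : ∀ᵐ x ∂μ, ∀ᵐ y ∂μ, 0 < g x T y := Measure.ae_ae_of_ae_prod hgpos
  obtain ⟨P, hP, hPinner, hPf⟩ := hg.exists_propagator hT f lam hf
  set E := Real.exp (T * lam m) with hE
  have hEpos : 0 < E := Real.exp_pos _
  set F := endpointDensity g T (f m) (fun y => E * f m y) with hF
  have hFeq : F = fun p => E * (f m p.1 * g p.1 T p.2 * f m p.2) := by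
    funext p
    simp only [hF, endpointDensity]
    ring
  have hint : IntegrableOn F (D ×ˢ D) := by
    rw [IntegrableOn, hprod, hFeq]
    exact (hP.integrable_prod hk hgm (f m) (f m)).const_mul E
  refine ⟨hint, (volume.restrict (D ×ˢ D)).withDensityᵥ F, ?_⟩
  have hval : ∀ G, MeasurableSet G →
      (volume.restrict (D ×ˢ D)).withDensityᵥ F G = ∫ q in G ∩ D ×ˢ D, F q := by
    intro G hG
    rw [withDensityᵥ_apply hint hG, Measure.restrict_restrict hG]
  refine ⟨hval, ?_, fun _ => ?_⟩
  · rintro ⟨n, hnm, hlam⟩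
    by_contra! hneg
    have hfm : Measurable (f m : EuclideanSpace ℝ (Fin d) → ℝ) :=
      (Lp.stronglyMeasurable (f m)).measurable
    have hA : MeasurableSet {x | 0 < f m x} := measurableSet_lt measurable_const hfm
    have hB : MeasurableSet {x | f m x < 0} := measurableSet_lt hfm measurable_const
    have hzero : μ.prod μ ({x | 0 < f m x} ×ˢ {x | f m x < 0}) = 0 := by
      set G := {x | 0 < f m x} ×ˢ {x | f m x < 0} with hGdef
      have hG : MeasurableSet G := hA.prod hB
      have hGnn := hneg G hG
      rw [withDensityᵥ_apply hint hG, hprod] at hGnn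
      have hFneg : ∀ᵐ q ∂(μ.prod μ).restrict G, F q < 0 := by
        filter_upwards [ae_restrict_of_ae hgpos, ae_restrict_mem hG] with q h1 h2
        rw [hFeq]
        exact mul_neg_of_pos_of_neg hEpos (mul_neg_of_pos_of_neg (mul_pos h2.1 h1) h2.2)
      have hintG : Integrable (fun q => -F q) ((μ.prod μ).restrict G) := by
        rw [IntegrableOn, hprod] at hint
        exact hint.restrict.neg
      have hFnn : 0 ≤ᵐ[(μ.prod μ).restrict G] fun q => -F q :=
        hFneg.mono fun q hq => (neg_pos.2 hq).le
      have h0 : ∫ q in G, -F q ∂(μ.prod μ) = 0 :=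
        le_antisymm (by rw [integral_neg]; linarith) (integral_nonneg_of_ae hFnn)
      have hae := (integral_eq_zero_iff_of_nonneg_ae hFnn hintG).1 h0
      have hfalse : ∀ᵐ q ∂(μ.prod μ).restrict G, False := by
        filter_upwards [hFneg, hae] with q h1 h2
        exact h1.ne (neg_eq_zero.1 h2)
      rw [← Measure.restrict_eq_zero]
      exact ae_eq_bot.1 (eventually_false_iff_eq_bot.1 hfalse)
    -- The sign of `f m` is arbitrary, so either of `f m` and `-f m` may serve as the ground state.
    have hsign : ∀ s : L2 D, 0 ≤ᵐ[μ] s → (s = f m ∨ s = -f m) → False := by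
      intro s hs hsm
      have hne : ∀ i, f i ≠ 0 := fun i => f.orthonormal.ne_zero i
      have hlt : Real.exp (-T * lam n) < Real.exp (-T * lam m) := by
        refine hP.eigenvalue_lt hk (s := s) (f := f n) (Real.exp_pos _) hs ?_ ?_ ?_ (hne n) ?_
          (hPf n)
        · rcases hsm with rfl | rfl
          exacts [hne m, neg_ne_zero.2 (hne m)]
        · rcases hsm with rfl | rfl
          · exact hPf m
          · rw [hP.map_neg, hPf, smul_neg]
        · intro φ
          rcases hsm with rfl | rfl
          · exact hPinner φ m
          · rw [inner_neg_right, inner_neg_right, hPinner, mul_neg]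
        · rcases hsm with rfl | rfl
          · exact f.orthonormal.2 hnm
          · rw [inner_neg_right, f.orthonormal.2 hnm, neg_zero]
      have := Real.exp_lt_exp.1 hlt
      nlinarith
    rw [Measure.prod_prod, mul_eq_zero] at hzero
    rcases hzero with h | h
    · refine hsign (-f m) ?_ (Or.inr rfl)
      filter_upwards [measure_eq_zero_iff_ae_notMem.1 h, Lp.coeFn_neg (f m)] with x h1 h2
      rw [h2]
      exact neg_nonneg.2 (not_lt.1 h1)
    · refine hsign (f m) ?_ (Or.inl rfl)
      filter_upwards [measure_eq_zero_iff_ae_notMem.1 h] with x h1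
      exact not_lt.1 h1
  · have hD : MeasurableSet (D ×ˢ D) := hDopen.measurableSet.prod hDopen.measurableSet
    rw [hval _ hD, inter_self, hprod, hFeq, integral_const_mul,
      hP.integral_prod_eq_inner hk hgm, hPf, real_inner_smul_right,
      real_inner_self_eq_norm_sq, f.orthonormal.1 m, hE, ← mul_assoc, ← Real.exp_add]
    simp
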